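/- Let $n\ge 0$ be an integer and let $\mathcal{B}_n$ be the flag variety of $\mathfrak{gl}(n)=\mathfrak{gl}(n,\mathbb{C})$, i.e. the variety of all Borel subalgebras (maximal solvable Lie subalgebras) of $\mathfrak{gl}(n)$, on which $GL(n)=GL(n,\mathbb{C})$ acts by the adjoint action $\mathrm{Ad}(g)X=gXg^{-1}$ (equivalently, the variety of full flags in $\mathbb{C}^n$). Let $K=GL(n-1)\subset GL(n)$ be embedded in the upper left corner, that is, $K$ consists of the matrices in $GL(n)$ whose last row and last column are those of the identity matrix, and let $B_{n-1}=K\cap B_n$, where $B_n\subset GL(n)$ is the subgroup of upper triangular matrices (for $n=0$ all these groups are trivial). Let $PIL(n)$ be the set of partitions of $\{1,\dots,n\}$ into lists, i.e. of finite sets $\{\sigma_1,\dots,\sigma_k\}$ of non-empty lists (tuples without repetitions) whose supports are pairwise disjoint with union $\{1,\dots,n\}$; for $n=0$ the only element of $PIL(0)$ is the empty partition. Then the number of $B_{n-1}$-orbits on $\mathcal{B}_n$ is finite and $$|B_{n-1}\backslash\mathcal{B}_n| = |PIL(n)|.$$ -/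

import Mathlib

open scoped Matrix

attribute [local instance 100] LieRing.ofAssociativeRing

namespace FlagOrbits

/-- The adjoint action of `g ∈ GL(n)` on `𝔤𝔩(n)`: `Ad(g) X = g X g⁻¹`. -/
noncomputable def Ad {n : ℕ} (g : GL (Fin n) ℂ) :
    Matrix (Fin n) (Fin n) ℂ ≃ₗ⁅ℂ⁆ Matrix (Fin n) (Fin n) ℂ :=
  Matrix.lieConj (g : Matrix (Fin n) (Fin n) ℂ) g.invertible

theorem Ad_apply {n : ℕ} (g : GL (Fin n) ℂ) (X : Matrix (Fin n) (Fin n) ℂ) :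
    Ad g X = (g : Matrix (Fin n) (Fin n) ℂ) * X * ((g⁻¹ : GL (Fin n) ℂ) : Matrix _ _ ℂ) := by
  simp [Ad]

/-- A Borel subalgebra of `𝔤𝔩(n)`: a maximal solvable Lie subalgebra. -/
def IsBorel {n : ℕ} (b : LieSubalgebra ℂ (Matrix (Fin n) (Fin n) ℂ)) : Prop :=
  Maximal (fun c : LieSubalgebra ℂ (Matrix (Fin n) (Fin n) ℂ) => LieAlgebra.IsSolvable c) b

/-- The image `Ad(g) b` of a Lie subalgebra `b` of `𝔤𝔩(n)`. -/
noncomputable def adMap {n : ℕ} (g : GL (Fin n) ℂ)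
    (b : LieSubalgebra ℂ (Matrix (Fin n) (Fin n) ℂ)) :
    LieSubalgebra ℂ (Matrix (Fin n) (Fin n) ℂ) :=
  b.map (Ad g : Matrix (Fin n) (Fin n) ℂ →ₗ⁅ℂ⁆ Matrix (Fin n) (Fin n) ℂ)

theorem mem_adMap {n : ℕ} (g : GL (Fin n) ℂ) (b : LieSubalgebra ℂ (Matrix (Fin n) (Fin n) ℂ))
    (X : Matrix (Fin n) (Fin n) ℂ) :
    X ∈ adMap g b ↔
      ((g⁻¹ : GL (Fin n) ℂ) : Matrix (Fin n) (Fin n) ℂ) * X * (g : Matrix (Fin n) (Fin n) ℂ) ∈ b := by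
  rw [adMap, LieSubalgebra.mem_map]
  constructor
  · rintro ⟨Y, hY, rfl⟩
    have : ((g⁻¹ : GL (Fin n) ℂ) : Matrix (Fin n) (Fin n) ℂ) * (Ad g Y) *
        (g : Matrix (Fin n) (Fin n) ℂ) = Y := by
      rw [Ad_apply]
      simp only [mul_assoc, Units.inv_mul, mul_one, Units.inv_mul_cancel_left]
    change _ * (Ad g Y) * _ ∈ b
    rwa [this]
  · intro h
    refine ⟨_, h, ?_⟩
    change Ad g _ = X
    rw [Ad_apply]
    simp only [mul_assoc, Units.mul_inv, mul_one, Units.mul_inv_cancel_left]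

theorem adMap_one {n : ℕ} (b : LieSubalgebra ℂ (Matrix (Fin n) (Fin n) ℂ)) : adMap 1 b = b := by
  ext X
  rw [mem_adMap]
  simp

theorem adMap_mul {n : ℕ} (g h : GL (Fin n) ℂ)
    (b : LieSubalgebra ℂ (Matrix (Fin n) (Fin n) ℂ)) :
    adMap (g * h) b = adMap g (adMap h b) := by
  ext X
  simp only [mem_adMap, mul_inv_rev, Units.val_mul, mul_assoc]

theorem adMap_mono {n : ℕ} (g : GL (Fin n) ℂ)
    {b c : LieSubalgebra ℂ (Matrix (Fin n) (Fin n) ℂ)} (h : b ≤ c) : adMap g b ≤ adMap g c := by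
  intro X hX
  rw [mem_adMap] at hX ⊢
  exact h hX

theorem isSolvable_adMap {n : ℕ} (g : GL (Fin n) ℂ)
    {b : LieSubalgebra ℂ (Matrix (Fin n) (Fin n) ℂ)} (h : LieAlgebra.IsSolvable b) :
    LieAlgebra.IsSolvable (adMap g b) :=
  (LieAlgebra.solvable_iff_equiv_solvable ((Ad g).lieSubalgebraMap b)).1 h

theorem IsBorel.adMap {n : ℕ} {b : LieSubalgebra ℂ (Matrix (Fin n) (Fin n) ℂ)} (hb : IsBorel b)
    (g : GL (Fin n) ℂ) : IsBorel (adMap g b) := by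
  refine ⟨isSolvable_adMap g hb.1, fun c hc hle => ?_⟩
  have h1 : b ≤ FlagOrbits.adMap g⁻¹ c := by
    have := adMap_mono g⁻¹ hle
    rwa [← adMap_mul, inv_mul_cancel, adMap_one] at this
  have h2 := adMap_mono g (hb.2 (isSolvable_adMap g⁻¹ hc) h1)
  rwa [← adMap_mul, mul_inv_cancel, adMap_one] at h2

/-- The flag variety of `𝔤𝔩(n)`, as the set of all Borel subalgebras of `𝔤𝔩(n)`. -/
def FlagVariety (n : ℕ) : Type :=
  {b : LieSubalgebra ℂ (Matrix (Fin n) (Fin n) ℂ) // IsBorel b}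

/-- `GL(n)` acts on the flag variety by the adjoint action. -/
noncomputable instance (n : ℕ) : MulAction (GL (Fin n) ℂ) (FlagVariety n) where
  smul g b := ⟨adMap g b.1, b.2.adMap g⟩
  one_smul b := Subtype.ext (adMap_one b.1)
  mul_smul g h b := Subtype.ext (adMap_mul g h b.1)

/-- `B_n`, the group of upper triangular matrices in `GL(n)`. -/
def upperBorel (n : ℕ) : Subgroup (GL (Fin n) ℂ) where
  carrier := {g | ∀ i j : Fin n, j < i → (g : Matrix (Fin n) (Fin n) ℂ) i j = 0}
  one_mem' := fun i j hij => by simp [Matrix.one_apply_ne hij.ne']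
  mul_mem' := fun {g h} hg hh i j hij => by
    have hg' : (g : Matrix (Fin n) (Fin n) ℂ).BlockTriangular id := fun i j hij => hg i j hij
    have hh' : (h : Matrix (Fin n) (Fin n) ℂ).BlockTriangular id := fun i j hij => hh i j hij
    exact (hg'.mul hh') hij
  inv_mem' := fun {g} hg i j hij => by
    have hg' : (g : Matrix (Fin n) (Fin n) ℂ).BlockTriangular id := fun i j hij => hg i j hij
    have := g.invertible
    rw [Matrix.coe_units_inv]
    exact Matrix.blockTriangular_inv_of_blockTriangular hg' hij

/-- `K = GL(n-1)`, embedded in `GL(n)` in the upper left corner: the matrices whose last row and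
last column agree with those of the identity matrix. It is trivial for `n = 0` and `n = 1`. -/
def cornerGL (n : ℕ) : Subgroup (GL (Fin n) ℂ) where
  carrier := {g | ∀ i j : Fin n, ((i : ℕ) + 1 = n ∨ (j : ℕ) + 1 = n) →
    (g : Matrix (Fin n) (Fin n) ℂ) i j = (1 : Matrix (Fin n) (Fin n) ℂ) i j}
  one_mem' := fun _ _ _ => rfl
  mul_mem' := fun {g h} hg hh i j hij => by
    rw [Units.val_mul, Matrix.mul_apply]
    rcases hij with hi | hj
    · rw [Finset.sum_congr rfl fun k _ => by rw [hg i k (Or.inl hi)], ← Matrix.mul_apply, one_mul,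
        hh i j (Or.inl hi)]
    · rw [Finset.sum_congr rfl fun k _ => by rw [hh k j (Or.inr hj)], ← Matrix.mul_apply, mul_one,
        hg i j (Or.inr hj)]
  inv_mem' := fun {g} hg i j hij => by
    rcases hij with hi | hj
    · have h := congrFun (congrFun (Units.mul_inv g) i) j
      rw [Matrix.mul_apply, Finset.sum_congr rfl fun k _ => by rw [hg i k (Or.inl hi)],
        ← Matrix.mul_apply, one_mul] at h
      exact h
    · have h := congrFun (congrFun (Units.inv_mul g) i) j
      rw [Matrix.mul_apply, Finset.sum_congr rfl fun k _ => by rw [hg k j (Or.inr hj)],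
        ← Matrix.mul_apply, mul_one] at h
      exact h

/-- `B_{n-1} = K ∩ B_n`, the group of upper triangular matrices in `K = GL(n-1)`. -/
def cornerBorel (n : ℕ) : Subgroup (GL (Fin n) ℂ) := cornerGL n ⊓ upperBorel n

/-- The set of `B_{n-1}`-orbits on the flag variety of `𝔤𝔩(n)`. -/
abbrev Orbits (n : ℕ) : Type := MulAction.orbitRel.Quotient (cornerBorel n) (FlagVariety n)

/-- The partitions of the finite set `A` into lists: finite sets of non-empty lists without
repetitions whose supports are pairwise disjoint and have union `A`. -/
def PILOn (A : Finset ℕ) : Set (Finset (List ℕ)) :=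
  {S | (∀ σ ∈ S, σ ≠ [] ∧ σ.Nodup) ∧
    (∀ σ ∈ S, ∀ τ ∈ S, σ ≠ τ → Disjoint σ.toFinset τ.toFinset) ∧
    S.biUnion List.toFinset = A}

/-- `PIL(n)`, the set of partitions of `{1, …, n}` into lists. -/
def PIL (n : ℕ) : Set (Finset (List ℕ)) := PILOn (Finset.Icc 1 n)

end FlagOrbits

namespace FlagOrbits

variable {n : ℕ}

/-! By Lie's theorem all Borel subalgebras are conjugate to the upper triangular one, whose
stabilizer is `B_n`, so the orbits are the double cosets `B_{n-1} \ GL(n) / B_n`. By Bruhat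
(`exists_bruhat`, `eq_of_mul_permGL_eq`) each one lies in a single cell `B_n u B_n`.

Inside a cell, `B_{n-1}` is the stabilizer of `e_n` in `B_n`, so the coset `B_{n-1} b` is recorded
by the vector `b⁻¹ e_n`, whose last entry is nonzero. What remains is the action on such vectors of
`B_n ∩ u B_n u⁻¹`, the unit group of the incidence algebra of the order `i ≤ j ∧ u i ≤ u j`. Its
orbits are represented by indicator vectors of antichains (`exists_mulVec_eq_indicator`,
`subset_of_mulVec_indicator`). An antichain is a set of positions on which `u` decreases, and here
it contains the last position.

Such a pair is a word with decreasing marked letters, the final letter being marked. Cutting after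
each mark gives lists in decreasing order of last letter, and every partition into lists has exactly
one such ordering. -/

/-- An upper triangular matrix with nonzero diagonal entries is an element of `B_n`. -/
theorem exists_mem_upperBorel_coe_eq (M : Matrix (Fin n) (Fin n) ℂ)
    (hM : ∀ i j, j < i → M i j = 0) (hd : ∀ i, M i i ≠ 0) :
    ∃ g ∈ upperBorel n, (g : Matrix (Fin n) (Fin n) ℂ) = M := by
  have hdet : M.det ≠ 0 := by
    rw [Matrix.det_of_isUpperTriangular (fun i j hij => hM i j hij)]
    exact Finset.prod_ne_zero_iff.2 fun i _ => hd i
  exact ⟨Matrix.GeneralLinearGroup.mkOfDetNeZero M hdet, hM, rfl⟩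

theorem diag_ne_zero_of_mem_upperBorel {g : GL (Fin n) ℂ} (hg : g ∈ upperBorel n) (i : Fin n) :
    (g : Matrix (Fin n) (Fin n) ℂ) i i ≠ 0 := by
  have hdet : (g : Matrix (Fin n) (Fin n) ℂ).det ≠ 0 := g.det_ne_zero
  rw [Matrix.det_of_isUpperTriangular (fun i j hij => hg i j hij)] at hdet
  exact Finset.prod_ne_zero_iff.1 hdet i (Finset.mem_univ i)

/-! ### Permutation matrices and the Bruhat decomposition -/

/-- The permutation matrix of `u`, with entries `1` at the positions `(i, u i)`. -/
noncomputable def permGL (u : Equiv.Perm (Fin n)) : GL (Fin n) ℂ where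
  val := u.permMatrix ℂ
  inv := u⁻¹.permMatrix ℂ
  val_inv := by rw [← Matrix.permMatrix_mul, inv_mul_cancel, Matrix.permMatrix_one]
  inv_val := by rw [← Matrix.permMatrix_mul, mul_inv_cancel, Matrix.permMatrix_one]

theorem permGL_inv (u : Equiv.Perm (Fin n)) : (permGL u)⁻¹ = permGL u⁻¹ := by
  ext i j; rfl

theorem permGL_apply (u : Equiv.Perm (Fin n)) (i j : Fin n) :
    (permGL u : Matrix (Fin n) (Fin n) ℂ) i j = if u i = j then 1 else 0 := by
  simp [permGL, PEquiv.toMatrix_apply, eq_comm]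

theorem permGL_mul_apply (u : Equiv.Perm (Fin n)) (M : Matrix (Fin n) (Fin n) ℂ) (i j : Fin n) :
    ((permGL u : Matrix (Fin n) (Fin n) ℂ) * M) i j = M (u i) j := by
  simp [Matrix.mul_apply, permGL_apply]

theorem mul_permGL_apply (u : Equiv.Perm (Fin n)) (M : Matrix (Fin n) (Fin n) ℂ) (i j : Fin n) :
    (M * (permGL u : Matrix (Fin n) (Fin n) ℂ)) i j = M i (u⁻¹ j) := by
  rw [Matrix.mul_apply, Finset.sum_eq_single (u⁻¹ j)]
  · simp [permGL_apply]
  · intro k _ hk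
    rw [permGL_apply, if_neg, mul_zero]
    rintro rfl
    simp at hk
  · simp

theorem conj_permGL_apply (u : Equiv.Perm (Fin n)) (M : Matrix (Fin n) (Fin n) ℂ) (i j : Fin n) :
    (((permGL u)⁻¹ : GL (Fin n) ℂ) * M * (permGL u : Matrix (Fin n) (Fin n) ℂ)) i j =
      M (u⁻¹ i) (u⁻¹ j) := by
  rw [mul_permGL_apply, permGL_inv, permGL_mul_apply]

/-- One step of the elimination: the first `m + 1` columns can be cleared once the first `m`
columns are. A column is cleared if it is a standard basis vector and the row of its nonzero entry
has no other nonzero entry. -/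
theorem exists_cleared_succ {g : GL (Fin n) ℂ} (m : Fin n)
    (hg : ∀ j < m, ∃ p, ∀ i, (g : Matrix (Fin n) (Fin n) ℂ) i j = (if i = p then 1 else 0) ∧
      (g : Matrix (Fin n) (Fin n) ℂ) p i = if i = j then 1 else 0) :
    ∃ b ∈ upperBorel n, ∃ c ∈ upperBorel n, ∀ j ≤ m, ∃ p, ∀ i,
      ((b * g * c : GL (Fin n) ℂ) : Matrix (Fin n) (Fin n) ℂ) i j = (if i = p then 1 else 0) ∧
      ((b * g * c : GL (Fin n) ℂ) : Matrix (Fin n) (Fin n) ℂ) p i = if i = j then 1 else 0 := by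
  classical
  set G : Matrix (Fin n) (Fin n) ℂ := g.val with hG
  -- The pivot is the lowest nonzero entry of column `m`, so clearing the column only adds row `r`
  -- to higher rows: an upper triangular operation.
  obtain ⟨r, hr0, hr⟩ : ∃ r, G r m ≠ 0 ∧ ∀ i, r < i → G i m = 0 := by
    have hne : (Finset.univ.filter fun i => G i m ≠ 0).Nonempty := by
      by_contra h
      rw [Finset.not_nonempty_iff_eq_empty, Finset.filter_eq_empty_iff] at h
      exact g.det_ne_zero (Matrix.det_eq_zero_of_column_eq_zero m fun i => by
        simpa using h (Finset.mem_univ i))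
    obtain ⟨r, hr, hmax⟩ := Finset.exists_max_image _ id hne
    refine ⟨r, (Finset.mem_filter.1 hr).2, fun i hi => ?_⟩
    by_contra h
    exact absurd (hmax i (by simpa using h)) (not_le.2 hi)
  obtain ⟨b, hb, hbM⟩ := exists_mem_upperBorel_coe_eq
    (Matrix.of fun i j : Fin n => if j = r then (if i = r then (G r m)⁻¹ else - G i m / G r m)
      else if i = j then 1 else 0)
    (by
      intro i j hij
      by_cases hj : j = r
      · subst hj; simp [hij.ne', hr i hij]
      · simp [hj, hij.ne'])
    (by
      intro i
      by_cases hi : i = r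
      · simp [hi, hr0]
      · simp [hi])
  have hbg : ∀ i j, ((b : Matrix (Fin n) (Fin n) ℂ) * G) i j =
      if i = r then G r j / G r m else G i j - G i m / G r m * G r j := by
    intro i j
    rw [hbM, Matrix.mul_apply]
    by_cases hi : i = r
    · subst hi
      rw [Finset.sum_eq_single i]
      · simp [div_eq_inv_mul]
      · intro k _ hk
        simp [hk, Ne.symm hk]
      · simp
    · rw [← Finset.add_sum_erase _ _ (Finset.mem_univ r), Finset.sum_eq_single i]
      · simp [hi]; ring
      · intro k hk hki
        simp [Finset.ne_of_mem_erase hk, Ne.symm hki]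
      · simp [hi]
  set H : Matrix (Fin n) (Fin n) ℂ := (b : Matrix (Fin n) (Fin n) ℂ) * G with hH
  -- Multiples of column `m` are subtracted from later columns to clear row `r` to the right of the
  -- pivot.
  obtain ⟨c, hc, hcM⟩ := exists_mem_upperBorel_coe_eq
    (Matrix.of fun i j : Fin n => if i = m ∧ m < j then - H r j
      else if i = j then 1 else 0)
    (by
      intro i j hij
      have : ¬ (i = m ∧ m < j) := by rintro ⟨rfl, h⟩; exact absurd h (not_lt.2 hij.le)
      simp [this, hij.ne'])
    (by
      intro i
      have : ¬ (i = m ∧ m < i) := by rintro ⟨rfl, h⟩; exact absurd h (lt_irrefl _)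
      simp [this])
  have hHc : ∀ i j, (H * (c : Matrix (Fin n) (Fin n) ℂ)) i j =
      if m < j then H i j - H i m * H r j else H i j := by
    intro i j
    rw [hcM, Matrix.mul_apply]
    split_ifs with hj
    · rw [← Finset.add_sum_erase _ _ (Finset.mem_univ m), Finset.sum_eq_single j]
      · simp [hj, hj.ne']; ring
      · intro k hk hkj
        simp [Finset.ne_of_mem_erase hk, hkj]
      · simp [hj.ne']
    · rw [Finset.sum_eq_single j]
      · simp [hj]
      · intro k _ hk
        simp [hj, hk]
      · simp
  refine ⟨b, hb, c, hc, fun j hj => ?_⟩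
  have hcoe : ((b * g * c : GL (Fin n) ℂ) : Matrix (Fin n) (Fin n) ℂ) =
      H * (c : Matrix (Fin n) (Fin n) ℂ) := rfl
  rw [hcoe]
  have hHm : ∀ i, H i m = if i = r then 1 else 0 := by
    intro i
    rw [hbg]
    split_ifs
    · exact div_self hr0
    · rw [div_mul_cancel₀ _ hr0, sub_self]
  rcases hj.eq_or_lt with rfl | hj
  · refine ⟨r, fun i => ⟨?_, ?_⟩⟩
    · rw [hHc, if_neg (lt_irrefl _), hHm]
    · rw [hHc, hHm, if_pos rfl]
      split_ifs with h1 h2 h2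
      · exact absurd h1 (by rw [h2]; exact lt_irrefl _)
      · ring
      · rw [h2, hHm, if_pos rfl]
      · obtain ⟨p, hp⟩ := hg i (lt_of_le_of_ne (not_lt.1 h1) h2)
        have hrp : r ≠ p := by
          rintro rfl
          exact hr0 (by rw [(hp j).2, if_neg (Ne.symm h2)])
        rw [hbg, if_pos rfl, (hp r).1, if_neg hrp, zero_div]
  · obtain ⟨p, hp⟩ := hg j hj
    -- Rows of earlier pivots vanish in column `m`, so `r` is a new row, and the operations leave
    -- the cleared columns and their pivot rows intact.
    have hrp : r ≠ p := by
      rintro rfl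
      exact hr0 (by rw [(hp m).2, if_neg hj.ne'])
    have hrj : G r j = 0 := by rw [(hp r).1, if_neg hrp]
    have hpm : G p m = 0 := by rw [(hp m).2, if_neg hj.ne']
    refine ⟨p, fun i => ⟨?_, ?_⟩⟩
    · rw [hHc, if_neg hj.le.not_gt, hbg, hrj]
      split_ifs with h1 h2 h2
      · exact absurd (h1.symm.trans h2) hrp
      · simp
      · rw [h2, (hp p).1]; simp
      · rw [(hp i).1]; simp [h2]
    · rw [hHc, hHm, if_neg hrp.symm, hbg, if_neg hrp.symm, hpm, (hp i).2]
      simp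

theorem exists_cleared (g : GL (Fin n) ℂ) (m : ℕ) :
    ∃ b ∈ upperBorel n, ∃ c ∈ upperBorel n, ∀ j : Fin n, (j : ℕ) < m → ∃ p, ∀ i,
      ((b * g * c : GL (Fin n) ℂ) : Matrix (Fin n) (Fin n) ℂ) i j = (if i = p then 1 else 0) ∧
      ((b * g * c : GL (Fin n) ℂ) : Matrix (Fin n) (Fin n) ℂ) p i = if i = j then 1 else 0 := by
  induction m with
  | zero => exact ⟨1, one_mem _, 1, one_mem _, fun j hj => absurd hj (Nat.not_lt_zero _)⟩
  | succ m ih =>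
    obtain ⟨b, hb, c, hc, h⟩ := ih
    by_cases hm : m < n
    · obtain ⟨b', hb', c', hc', h'⟩ := exists_cleared_succ ⟨m, hm⟩ h
      refine ⟨b' * b, mul_mem hb' hb, c * c', mul_mem hc hc', fun j hj => ?_⟩
      have heq : b' * b * g * (c * c') = b' * (b * g * c) * c' := by group
      rw [heq]
      exact h' j (Fin.le_def.2 (Nat.lt_succ_iff.1 hj))
    · exact ⟨b, hb, c, hc, fun j _ => h j (by omega)⟩

/-- The Bruhat decomposition of `GL(n)`. -/
theorem exists_bruhat (g : GL (Fin n) ℂ) :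
    ∃ b ∈ upperBorel n, ∃ u : Equiv.Perm (Fin n), ∃ c ∈ upperBorel n, g = b * permGL u * c := by
  obtain ⟨b, hb, c, hc, h⟩ := exists_cleared g n
  choose p hp using fun j : Fin n => h j j.2
  have hinj : Function.Injective p := by
    intro j k hjk
    have h1 := (hp k j).2
    rw [← hjk, (hp j j).2, if_pos rfl] at h1
    by_contra hne
    simp [hne] at h1
  let σ : Equiv.Perm (Fin n) := Equiv.ofBijective p (Finite.injective_iff_bijective.1 hinj)
  -- `p` sends a column to its pivot row, whereas `permGL u` has its ones at `(i, u i)`; hence the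
  -- inverse.
  refine ⟨b⁻¹, inv_mem hb, σ⁻¹, c⁻¹, inv_mem hc, ?_⟩
  have key : b * g * c = permGL σ⁻¹ := by
    ext i j
    rw [(hp j i).1, permGL_apply]
    congr 1
    rw [Equiv.Perm.inv_eq_iff_eq]
    rfl
  rw [← key]
  group

/-- Uniqueness of the permutation in the Bruhat decomposition. -/
theorem eq_of_mul_permGL_eq {u v : Equiv.Perm (Fin n)} {b c : GL (Fin n) ℂ}
    (hb : b ∈ upperBorel n) (hc : c ∈ upperBorel n) (h : b * permGL u = permGL v * c) :
    u = v := by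
  -- The entry at `(i, u i)` is the nonzero `b i i` on the left and `c (v i) (u i)` on the right.
  have hle : ∀ i, v i ≤ u i := by
    intro i
    have h1 := congrArg (fun g : GL (Fin n) ℂ => (g : Matrix (Fin n) (Fin n) ℂ) i (u i)) h
    simp only [Units.val_mul] at h1
    rw [mul_permGL_apply, permGL_mul_apply, show u⁻¹ (u i) = i from u.symm_apply_apply i] at h1
    by_contra hlt
    rw [hc _ _ (not_le.1 hlt)] at h1
    exact diag_ne_zero_of_mem_upperBorel hb i h1
  -- Both permutations have the same sum of values, so the pointwise inequality is an equality.
  have hsum : ∑ i, ((u i : Fin n) : ℕ) = ∑ i, ((v i : Fin n) : ℕ) := by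
    rw [Equiv.sum_comp u (fun i : Fin n => (i : ℕ)), Equiv.sum_comp v (fun i : Fin n => (i : ℕ))]
  have := (Finset.sum_eq_sum_iff_of_le (fun i _ => Fin.le_def.1 (hle i))).1 hsum.symm
  ext i
  exact (this i (Finset.mem_univ i)).symm

/-! ### Double cosets inside a Bruhat cell -/

/-- Upper triangularity already fixes the off-diagonal part of the last row, so `B_{n-1}` is the
stabilizer of `e_n` in `B_n`. -/
theorem mem_cornerBorel_of_last {g : GL (Fin n) ℂ} (hg : g ∈ upperBorel n)
    (h : ∀ i j : Fin n, (j : ℕ) + 1 = n →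
      (g : Matrix (Fin n) (Fin n) ℂ) i j = (1 : Matrix (Fin n) (Fin n) ℂ) i j) :
    g ∈ cornerBorel n := by
  refine ⟨fun i j hij => ?_, hg⟩
  rcases hij with hi | hj
  · rcases eq_or_ne i j with rfl | hne
    · exact h i i hi
    · rw [Matrix.one_apply_ne hne]
      exact hg i j (by rw [Fin.lt_def]; rw [Ne, Fin.ext_iff] at hne; omega)
  · exact h i j hj

/-- The permutations of `Fin n` with a marked set of positions, containing the last position, on
which the permutation is decreasing. -/
def markedPerms (n : ℕ) : Set (Equiv.Perm (Fin n) × Finset (Fin n)) :=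
  {x | (∀ i : Fin n, (i : ℕ) + 1 = n → i ∈ x.2) ∧
    ∀ i ∈ x.2, ∀ j ∈ x.2, i < j → x.1 j < x.1 i}

/-- Any vector can be mapped to the indicator vector of an antichain by an invertible matrix in the
incidence algebra of the order `i ≤ j ∧ u i ≤ u j`. -/
theorem exists_mulVec_eq_indicator (u : Equiv.Perm (Fin n)) (v : Fin n → ℂ) :
    ∃ A : Finset (Fin n), (∀ i ∈ A, ∀ j ∈ A, i < j → u j < u i) ∧
      (∀ i, v i ≠ 0 → (∀ j, v j ≠ 0 → j ≤ i) → i ∈ A) ∧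
      ∃ k ∈ upperBorel n, (permGL u)⁻¹ * k * permGL u ∈ upperBorel n ∧
        (k : Matrix (Fin n) (Fin n) ℂ) *ᵥ v = fun i => if i ∈ A then 1 else 0 := by
  classical
  -- The maximal elements of the support of `v` for the order `i ≤ j ∧ u i ≤ u j`.
  let A : Finset (Fin n) := Finset.univ.filter fun i =>
    v i ≠ 0 ∧ ∀ j, v j ≠ 0 → i < j → u j < u i
  have hA : ∀ i, i ∈ A ↔ v i ≠ 0 ∧ ∀ j, v j ≠ 0 → i < j → u j < u i := fun i => by simp [A]
  have hex : ∀ i, v i ≠ 0 → ∃ j, j ∈ A ∧ i ≤ j ∧ u i ≤ u j := by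
    intro i hi
    obtain ⟨j, hj, hmax⟩ := Finset.exists_max_image
      (Finset.univ.filter fun j => v j ≠ 0 ∧ i ≤ j ∧ u i ≤ u j) id ⟨i, by simp [hi]⟩
    simp only [Finset.mem_filter, Finset.mem_univ, true_and, id] at hj hmax
    refine ⟨j, (hA j).2 ⟨hj.1, fun l hl hjl => ?_⟩, hj.2⟩
    by_contra hlt
    exact absurd (hmax l ⟨hl, hj.2.1.trans hjl.le, hj.2.2.trans (not_lt.1 hlt)⟩) hjl.not_ge
  choose! a haA hai hau using hex
  -- Rescale the entries at maximal elements to `1`, and kill every other nonzero entry using a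
  -- maximal element `a i` above it.
  let M : Matrix (Fin n) (Fin n) ℂ := Matrix.of fun i j =>
    if i ∈ A then (if i = j then (v i)⁻¹ else 0)
    else (if i = j then 1 else 0) - if v i ≠ 0 ∧ j = a i then v i / v (a i) else 0
  have hM : ∀ i j, ¬ (i ≤ j ∧ u i ≤ u j) → M i j = 0 := by
    intro i j hij
    have hne : i ≠ j := by rintro rfl; exact hij ⟨le_rfl, le_rfl⟩
    have hne' : ¬ (v i ≠ 0 ∧ j = a i) := by
      rintro ⟨h, rfl⟩
      exact hij ⟨hai i h, hau i h⟩
    simp only [M, Matrix.of_apply, if_neg hne, if_neg hne', sub_zero, ite_self]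
  obtain ⟨k, hk, hkM⟩ := exists_mem_upperBorel_coe_eq M
    (fun i j hij => hM i j fun h => absurd h.1 (not_le.2 hij))
    (by
      intro i
      by_cases hi : i ∈ A
      · simpa [M, hi] using ((hA i).1 hi).1
      · have : ¬ (v i ≠ 0 ∧ i = a i) := by
          rintro ⟨h, h'⟩
          exact hi (h' ▸ haA i h)
        simp only [M, Matrix.of_apply, if_neg hi, if_neg this]
        simp)
  refine ⟨A, fun i hi j hj hij => ((hA i).1 hi).2 j ((hA j).1 hj).1 hij,
    fun i hi hmax => (hA i).2 ⟨hi, fun j hj hij => absurd (hmax j hj) (not_le.2 hij)⟩,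
    k, hk, ?_, ?_⟩
  · intro i j hij
    rw [Units.val_mul, Units.val_mul, conj_permGL_apply, hkM]
    refine hM _ _ fun h => absurd h.2 (not_le.2 ?_)
    rwa [show u (u⁻¹ i) = i from u.apply_symm_apply i,
      show u (u⁻¹ j) = j from u.apply_symm_apply j]
  · rw [hkM]
    ext i
    rw [Matrix.mulVec, dotProduct]
    by_cases hi : i ∈ A
    · simp [M, hi, ((hA i).1 hi).1]
    · by_cases hv : v i = 0
      · simp [M, hi, hv]
      · have : v (a i) ≠ 0 := ((hA _).1 (haA i hv)).1
        simp [M, hi, hv, sub_mul, Finset.sum_sub_distrib, this]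

/-- The indicator vectors of distinct antichains are not conjugate under the incidence algebra. -/
theorem subset_of_mulVec_indicator {u : Equiv.Perm (Fin n)} {A A' : Finset (Fin n)}
    (hA : ∀ i ∈ A, ∀ j ∈ A, i < j → u j < u i) {k : GL (Fin n) ℂ} (hk : k ∈ upperBorel n)
    (hk' : (permGL u)⁻¹ * k * permGL u ∈ upperBorel n)
    (h : (k : Matrix (Fin n) (Fin n) ℂ) *ᵥ (fun i => if i ∈ A then 1 else 0) =
      fun i => if i ∈ A' then 1 else 0) : A ⊆ A' := by
  intro i hi
  have h1 := congrFun h i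
  -- For `i ∈ A`, the antichain condition makes `k i j` vanish for all other `j ∈ A`, so entry `i`
  -- of the image is the nonzero `k i i`.
  rw [Matrix.mulVec, dotProduct, Finset.sum_eq_single i] at h1
  · by_contra hi'
    rw [if_pos hi, if_neg hi', mul_one] at h1
    exact diag_ne_zero_of_mem_upperBorel hk i h1
  · intro j _ hji
    split_ifs with hj
    · rcases lt_or_gt_of_ne hji with hlt | hlt
      · rw [hk i j hlt, zero_mul]
      · have h2 := hk' (u i) (u j) (hA i hi j hj hlt)
        rw [Units.val_mul, Units.val_mul, conj_permGL_apply,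
          show u⁻¹ (u i) = i from u.symm_apply_apply i,
          show u⁻¹ (u j) = j from u.symm_apply_apply j] at h2
        rw [h2, zero_mul]
    · exact mul_zero _
  · simp

/-- An upper triangular matrix whose last column is the indicator vector of `A`. -/
theorem exists_lastCol_eq_indicator (A : Finset (Fin n))
    (hA : ∀ i : Fin n, (i : ℕ) + 1 = n → i ∈ A) :
    ∃ t ∈ upperBorel n, ∀ i j : Fin n, (j : ℕ) + 1 = n →
      (t : Matrix (Fin n) (Fin n) ℂ) i j = if i ∈ A then 1 else 0 := by
  classical
  obtain ⟨t, ht, htM⟩ := exists_mem_upperBorel_coe_eq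
    (Matrix.of fun i j : Fin n => if (j : ℕ) + 1 = n then (if i ∈ A then (1 : ℂ) else 0)
      else if i = j then 1 else 0)
    (by
      intro i j hij
      have h1 : ¬ ((j : ℕ) + 1 = n) := by have := i.2; rw [Fin.lt_def] at hij; omega
      simp [h1, hij.ne'])
    (by
      intro i
      by_cases hi : (i : ℕ) + 1 = n
      · simp [hi, hA i hi]
      · simp [hi])
  exact ⟨t, ht, fun i j hj => by simp [htM, hj]⟩

theorem mul_apply_eq_mulVec (M N : Matrix (Fin n) (Fin n) ℂ) (i j : Fin n) :
    (M * N) i j = (M *ᵥ fun l => N l j) i := rfl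

/-- Normalize the last column of `b⁻¹` to an indicator by some `k`; then `t⁻¹ k b⁻¹` fixes `e_n`,
and the conjugate of `k` by `permGL u` is absorbed on the right. Any admissible `t` works, so one
`t` can be fixed in advance for each pair. -/
theorem exists_cornerBorel_normalForm (u : Equiv.Perm (Fin n)) {b : GL (Fin n) ℂ}
    (hb : b ∈ upperBorel n) :
    ∃ A : Finset (Fin n), (u, A) ∈ markedPerms n ∧ ∀ t ∈ upperBorel n,
      (∀ i j : Fin n, (j : ℕ) + 1 = n →
        (t : Matrix (Fin n) (Fin n) ℂ) i j = if i ∈ A then 1 else 0) →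
      ∃ c ∈ cornerBorel n, ∃ d ∈ upperBorel n,
        b * permGL u = c * (t⁻¹ * permGL u) * d := by
  cases n with
  | zero =>
    exact ⟨∅, ⟨fun i => i.elim0, fun i => i.elim0⟩, fun t _ _ => ⟨1, one_mem _, 1, one_mem _,
      Units.ext (Subsingleton.elim _ _)⟩⟩
  | succ m =>
    have hb' := inv_mem hb
    obtain ⟨A, hA, hAmax, k, hk, hk', hkv⟩ := exists_mulVec_eq_indicator u
      (fun i => ((b⁻¹ : GL (Fin (m + 1)) ℂ) : Matrix (Fin (m + 1)) (Fin (m + 1)) ℂ) i (Fin.last m))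
    refine ⟨A, ⟨fun i hi => ?_, hA⟩, fun t ht htA => ?_⟩
    · obtain rfl : i = Fin.last m := Fin.ext (by simpa using hi)
      exact hAmax _ (diag_ne_zero_of_mem_upperBorel hb' _) fun j _ => Fin.le_last j
    · have hc : t⁻¹ * (k * b⁻¹) ∈ cornerBorel (m + 1) := by
        refine mem_cornerBorel_of_last (mul_mem (inv_mem ht) (mul_mem hk hb')) fun i j hj => ?_
        obtain rfl : j = Fin.last m := Fin.ext (by simpa using hj)
        have h1 : (fun l => ((k * b⁻¹ : GL (Fin (m + 1)) ℂ) : Matrix (Fin (m + 1)) (Fin (m + 1)) ℂ)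
            l (Fin.last m)) =
            fun l => (t : Matrix (Fin (m + 1)) (Fin (m + 1)) ℂ) l (Fin.last m) := by
          ext l
          rw [Units.val_mul, mul_apply_eq_mulVec, hkv, htA l _ (by simp)]
        rw [Units.val_mul, mul_apply_eq_mulVec, h1, ← mul_apply_eq_mulVec, Units.inv_mul]
      refine ⟨_, inv_mem hc, _, hk', ?_⟩
      group

/-- Bruhat uniqueness gives equal permutations. Then `t c⁻¹ s⁻¹` lies in `B_n ∩ u B_n u⁻¹` and, as
`c` fixes `e_n`, carries one indicator to the other; it and its inverse give the two inclusions. -/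
theorem markedPerms_ext {x y : Equiv.Perm (Fin n) × Finset (Fin n)} (hx : x ∈ markedPerms n)
    (hy : y ∈ markedPerms n) {s t c d : GL (Fin n) ℂ} (hs : s ∈ upperBorel n)
    (hsx : ∀ i j : Fin n, (j : ℕ) + 1 = n →
        (s : Matrix (Fin n) (Fin n) ℂ) i j = if i ∈ x.2 then 1 else 0)
    (ht : t ∈ upperBorel n)
    (hty : ∀ i j : Fin n, (j : ℕ) + 1 = n →
        (t : Matrix (Fin n) (Fin n) ℂ) i j = if i ∈ y.2 then 1 else 0)
    (hc : c ∈ cornerBorel n) (hd : d ∈ upperBorel n)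
    (h : s⁻¹ * permGL x.1 = c * (t⁻¹ * permGL y.1) * d) : x = y := by
  obtain ⟨u, A⟩ := x
  obtain ⟨v, A'⟩ := y
  simp only at hsx hty h
  obtain rfl : u = v := by
    refine eq_of_mul_permGL_eq (b := t * c⁻¹ * s⁻¹) (c := d)
      (mul_mem (mul_mem ht (inv_mem hc.2)) (inv_mem hs)) hd ?_
    rw [mul_assoc, h]
    group
  have hkd : (permGL u)⁻¹ * (t * c⁻¹ * s⁻¹) * permGL u = d := by
    rw [mul_assoc, mul_assoc, h]
    group
  have hkd' : (permGL u)⁻¹ * (t * c⁻¹ * s⁻¹)⁻¹ * permGL u = d⁻¹ := by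
    rw [← hkd]
    group
  have hk : t * c⁻¹ * s⁻¹ ∈ upperBorel n := mul_mem (mul_mem ht (inv_mem hc.2)) (inv_mem hs)
  cases n with
  | zero => exact Prod.ext rfl (Subsingleton.elim _ _)
  | succ m =>
    have hsl : (fun i => (s : Matrix (Fin (m + 1)) (Fin (m + 1)) ℂ) i (Fin.last m)) =
        fun i => if i ∈ A then 1 else 0 :=
      funext fun i => hsx i _ (by simp)
    have htl : (fun i => (t : Matrix (Fin (m + 1)) (Fin (m + 1)) ℂ) i (Fin.last m)) =
        fun i => if i ∈ A' then 1 else 0 :=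
      funext fun i => hty i _ (by simp)
    have hcl : (fun i => ((c⁻¹ : GL (Fin (m + 1)) ℂ) : Matrix (Fin (m + 1)) (Fin (m + 1)) ℂ) i
        (Fin.last m)) =
        fun i => (1 : Matrix (Fin (m + 1)) (Fin (m + 1)) ℂ) i (Fin.last m) :=
      funext fun i => (inv_mem hc).1 i _ (Or.inr (by simp))
    have key : ((t * c⁻¹ * s⁻¹ : GL (Fin (m + 1)) ℂ) : Matrix (Fin (m + 1)) (Fin (m + 1)) ℂ) *ᵥ
        (fun i => if i ∈ A then 1 else 0) = fun i => if i ∈ A' then 1 else 0 := by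
      rw [← hsl, ← htl]
      ext i
      rw [← mul_apply_eq_mulVec, ← Units.val_mul, inv_mul_cancel_right, Units.val_mul,
        mul_apply_eq_mulVec, hcl, ← mul_apply_eq_mulVec, mul_one]
    have hinvkey : (((t * c⁻¹ * s⁻¹)⁻¹ : GL (Fin (m + 1)) ℂ) : Matrix (Fin (m + 1)) (Fin (m + 1)) ℂ) *ᵥ
        (fun i => if i ∈ A' then 1 else 0) = fun i => if i ∈ A then 1 else 0 := by
      rw [← key, Matrix.mulVec_mulVec, Units.inv_mul, Matrix.one_mulVec]
    refine Prod.ext rfl (Finset.Subset.antisymm ?_ ?_)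
    · exact subset_of_mulVec_indicator hx.2 hk (hkd ▸ hd) key
    · exact subset_of_mulVec_indicator hy.2 (inv_mem hk) (hkd' ▸ inv_mem hd) hinvkey

/-! ### Borel subalgebras: Lie's theorem and the stabilizer of the upper triangular algebra -/

/-- The Lie algebra of upper triangular matrices. -/
def upperAlg (n : ℕ) : LieSubalgebra ℂ (Matrix (Fin n) (Fin n) ℂ) where
  carrier := {X | ∀ i j, j < i → X i j = 0}
  zero_mem' := fun _ _ _ => rfl
  add_mem' := fun {X Y} hX hY i j hij => by rw [Matrix.add_apply, hX i j hij, hY i j hij, add_zero]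
  smul_mem' := fun c X hX i j hij => by rw [Matrix.smul_apply, hX i j hij, smul_zero]
  lie_mem' := fun {X Y} hX hY i j hij => by
    have hX' : X.BlockTriangular id := fun i j hij => hX i j hij
    have hY' : Y.BlockTriangular id := fun i j hij => hY i j hij
    rw [LieRing.of_associative_ring_bracket, Matrix.sub_apply, (hX'.mul hY') hij,
      (hY'.mul hX') hij, sub_zero]

/-- Products of such matrices start on superdiagonal `2k`, which suffices for `k ≥ 1`; for `k = 0`
the diagonal entries of the commutator cancel. This drives the solvability of `upperAlg`. -/
theorem lie_apply_eq_zero {X Y : Matrix (Fin n) (Fin n) ℂ} {k : ℕ}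
    (hX : ∀ i j : Fin n, (j : ℕ) < i + k → X i j = 0)
    (hY : ∀ i j : Fin n, (j : ℕ) < i + k → Y i j = 0) (i j : Fin n) (hij : (j : ℕ) < i + (k + 1)) :
    ⁅X, Y⁆ i j = 0 := by
  rw [LieRing.of_associative_ring_bracket, Matrix.sub_apply, Matrix.mul_apply, Matrix.mul_apply,
    ← Finset.sum_sub_distrib]
  refine Finset.sum_eq_zero fun l _ => ?_
  by_cases h1 : (l : ℕ) < i + k
  · rw [hX i l h1, hY i l h1]; ring
  · by_cases h2 : (j : ℕ) < l + k
    · rw [hX l j h2, hY l j h2]; ring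
    · obtain rfl : l = i := Fin.ext (by omega)
      obtain rfl : l = j := Fin.ext (by omega)
      ring

theorem derivedSeries_upperAlg_apply (k : ℕ) (X : upperAlg n)
    (hX : X ∈ LieAlgebra.derivedSeries ℂ (upperAlg n) k) (i j : Fin n) (hij : (j : ℕ) < i + k) :
    (X : Matrix (Fin n) (Fin n) ℂ) i j = 0 := by
  induction k generalizing X i j with
  | zero => exact X.2 i j (Fin.lt_def.2 hij)
  | succ k ih =>
    rw [LieAlgebra.derivedSeries_def, LieAlgebra.derivedSeriesOfIdeal_succ,
      ← LieSubmodule.mem_toSubmodule, LieSubmodule.lieIdeal_oper_eq_linear_span'] at hX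
    induction hX using Submodule.span_induction with
    | mem X hX =>
      obtain ⟨Y, hY, Z, hZ, rfl⟩ := hX
      exact lie_apply_eq_zero (fun i j => ih Y hY i j) (fun i j => ih Z hZ i j) i j hij
    | zero => rfl
    | add X Y _ _ hX hY =>
      change (X : Matrix (Fin n) (Fin n) ℂ) i j + (Y : Matrix (Fin n) (Fin n) ℂ) i j = 0
      rw [hX, hY, add_zero]
    | smul c X _ hX =>
      change c • (X : Matrix (Fin n) (Fin n) ℂ) i j = 0
      rw [hX, smul_zero]

theorem isSolvable_upperAlg (n : ℕ) : LieAlgebra.IsSolvable (upperAlg n) := by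
  refine LieAlgebra.IsSolvable.mk (R := ℂ) (k := n) ?_
  rw [LieSubmodule.eq_bot_iff]
  intro X hX
  ext i j
  exact derivedSeries_upperAlg_apply n X hX i j (by omega)

/-- A finite-dimensional representation of a solvable Lie algebra has a flag of subrepresentations,
given by the initial segments of a linearly independent family. -/
theorem exists_linearIndependent_lie_mem_span {L V : Type*} [LieRing L] [LieAlgebra ℂ L]
    [AddCommGroup V] [Module ℂ V] [FiniteDimensional ℂ V] [LieRingModule L V] [LieModule ℂ L V]
    [LieAlgebra.IsSolvable L] (m : ℕ) (hm : m ≤ Module.finrank ℂ V) :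
    ∃ e : Fin m → V, LinearIndependent ℂ e ∧
      ∀ (x : L) (j : Fin m), ⁅x, e j⁆ ∈ Submodule.span ℂ (e '' Set.Iic j) := by
  induction m with
  | zero => exact ⟨Fin.elim0, linearIndependent_empty_type, fun _ j => j.elim0⟩
  | succ m ih =>
    obtain ⟨e, he, hinv⟩ := ih (by omega)
    let N : LieSubmodule ℂ L V :=
      { Submodule.span ℂ (Set.range e) with
        lie_mem := by
          intro x v hv
          change ⁅x, v⁆ ∈ Submodule.span ℂ (Set.range e)
          induction hv using Submodule.span_induction with
          | mem v hv =>
            obtain ⟨j, rfl⟩ := hv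
            exact Submodule.span_mono (Set.image_subset_range _ _) (hinv x j)
          | zero => rw [lie_zero]; exact zero_mem _
          | add v w _ _ hv hw => rw [lie_add]; exact add_mem hv hw
          | smul c v _ hv => rw [lie_smul]; exact Submodule.smul_mem _ c hv }
    have hNmem : ∀ v, v ∈ N ↔ v ∈ Submodule.span ℂ (Set.range e) := fun v => Iff.rfl
    obtain ⟨w, hw⟩ : ∃ w, w ∉ N := by
      by_contra! h
      have htop : Submodule.span ℂ (Set.range e) = ⊤ := eq_top_iff.2 fun v _ => h v
      have := finrank_span_eq_card he
      rw [htop, finrank_top, Fintype.card_fin] at this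
      omega
    have : Nontrivial (V ⧸ N) :=
      nontrivial_of_ne (LieSubmodule.Quotient.mk w) 0 fun h =>
        hw ((Submodule.Quotient.mk_eq_zero (p := N.toSubmodule)).1 h)
    -- A common eigenvector in the quotient by the flag built so far lifts to the next flag vector.
    obtain ⟨χ, hχ⟩ := LieModule.exists_nontrivial_weightSpace_of_isSolvable ℂ L (V ⧸ N)
    obtain ⟨⟨q, hq⟩, hq0⟩ := exists_ne (0 : LieModule.weightSpace (V ⧸ N) χ)
    obtain ⟨v, rfl⟩ := Submodule.Quotient.mk_surjective N.toSubmodule q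
    have hvN : v ∉ N := fun h => hq0 (Subtype.ext
      ((Submodule.Quotient.mk_eq_zero (p := N.toSubmodule)).2 h))
    rw [LieModule.mem_weightSpace] at hq
    refine ⟨Fin.snoc e v, linearIndependent_finSnoc.2 ⟨he, hvN⟩, fun x j => ?_⟩
    induction j using Fin.lastCases with
    | last =>
      rw [Fin.snoc_last]
      have h1 : ⁅x, v⁆ - χ x • v ∈ N :=
        (Submodule.Quotient.eq N.toSubmodule).1 (hq x)
      have h2 : Submodule.span ℂ (Set.range e) ≤
          Submodule.span ℂ ((Fin.snoc e v : Fin (m + 1) → V) '' Set.Iic (Fin.last m)) := by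
        refine Submodule.span_mono ?_
        rintro _ ⟨i, rfl⟩
        exact ⟨i.castSucc, Fin.le_last _, by rw [Fin.snoc_castSucc]⟩
      have h3 : v ∈ Submodule.span ℂ
          ((Fin.snoc e v : Fin (m + 1) → V) '' Set.Iic (Fin.last m)) :=
        Submodule.subset_span ⟨Fin.last m, Set.mem_Iic.2 le_rfl, by rw [Fin.snoc_last]⟩
      have h4 := add_mem (h2 h1) (Submodule.smul_mem _ (χ x) h3)
      rwa [sub_add_cancel] at h4
    | cast j =>
      rw [Fin.snoc_castSucc]
      refine Submodule.span_mono ?_ (hinv x j)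
      rintro _ ⟨i, hi, rfl⟩
      exact ⟨i.castSucc, Fin.castSucc_le_castSucc_iff.2 hi, by rw [Fin.snoc_castSucc]⟩

/-- A solvable Lie algebra of matrices is simultaneously triangularizable. -/
theorem exists_le_adMap_upperAlg (b : LieSubalgebra ℂ (Matrix (Fin n) (Fin n) ℂ))
    (hb : LieAlgebra.IsSolvable b) : ∃ g : GL (Fin n) ℂ, b ≤ adMap g (upperAlg n) := by
  let f : Matrix (Fin n) (Fin n) ℂ ≃ₗ⁅ℂ⁆ Module.End ℂ (Fin n → ℂ) := lieEquivMatrix'.symm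
  let c : LieSubalgebra ℂ (Module.End ℂ (Fin n → ℂ)) :=
    b.map (f : Matrix (Fin n) (Fin n) ℂ →ₗ⁅ℂ⁆ Module.End ℂ (Fin n → ℂ))
  have hc : LieAlgebra.IsSolvable c :=
    (LieAlgebra.solvable_iff_equiv_solvable (f.lieSubalgebraMap b)).1 hb
  obtain ⟨e, he, hinv⟩ := exists_linearIndependent_lie_mem_span (L := c) (V := Fin n → ℂ) n (by simp)
  -- The flag vectors are the columns of `g`, so `g⁻¹` sends `e l` to the `l`-th standard basis
  -- vector.
  have hunit : IsUnit (Matrix.of fun i j => e j i) :=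
    Matrix.linearIndependent_cols_iff_isUnit.1 he
  obtain ⟨g, hg⟩ := hunit
  refine ⟨g, fun X hX => ?_⟩
  rw [mem_adMap]
  intro i j hij
  have h1 : X *ᵥ e j ∈ Submodule.span ℂ (e '' Set.Iic j) := by
    have := hinv ⟨f X, ⟨X, hX, rfl⟩⟩ j
    exact this
  have hge : ∀ l, ((g⁻¹ : GL (Fin n) ℂ) : Matrix (Fin n) (Fin n) ℂ) *ᵥ e l =
      fun i => (1 : Matrix (Fin n) (Fin n) ℂ) i l := by
    intro l
    rw [← Units.inv_mul g, hg]
    rfl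
  have h2 : ∀ y ∈ Submodule.span ℂ (e '' Set.Iic j),
      (((g⁻¹ : GL (Fin n) ℂ) : Matrix (Fin n) (Fin n) ℂ) *ᵥ y) i = 0 := by
    intro y hy
    induction hy using Submodule.span_induction with
    | mem y hy =>
      obtain ⟨l, hl, rfl⟩ := hy
      rw [hge]
      exact Matrix.one_apply_ne (lt_of_le_of_lt hl hij).ne'
    | zero => simp
    | add y z _ _ hy hz => rw [Matrix.mulVec_add, Pi.add_apply, hy, hz, add_zero]
    | smul c y _ hy => rw [Matrix.mulVec_smul, Pi.smul_apply, hy, smul_zero]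
  have h3 := h2 _ h1
  rw [Matrix.mulVec_mulVec] at h3
  rw [hg, mul_apply_eq_mulVec]
  exact h3

theorem adMap_upperAlg_of_mem {g : GL (Fin n) ℂ} (hg : g ∈ upperBorel n) :
    adMap g (upperAlg n) = upperAlg n := by
  have hle : ∀ g ∈ upperBorel n, adMap g (upperAlg n) ≤ upperAlg n := by
    intro g hg X hX
    rw [mem_adMap] at hX
    have h1 : (g : Matrix (Fin n) (Fin n) ℂ).BlockTriangular id := fun i j hij => hg i j hij
    have h2 : ((g⁻¹ : GL (Fin n) ℂ) : Matrix (Fin n) (Fin n) ℂ).BlockTriangular id :=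
      fun i j hij => inv_mem hg i j hij
    have h3 := (h1.mul (show Matrix.BlockTriangular _ id from fun i j hij => hX i j hij)).mul h2
    have h4 : X = (g : Matrix (Fin n) (Fin n) ℂ) * ((g⁻¹ : GL (Fin n) ℂ) * X * g) *
        ((g⁻¹ : GL (Fin n) ℂ) : Matrix (Fin n) (Fin n) ℂ) := by
      simp only [mul_assoc, Units.mul_inv, mul_one, Units.mul_inv_cancel_left]
    rw [h4]
    exact fun i j hij => h3 hij
  refine le_antisymm (hle g hg) ?_
  have := adMap_mono g (hle _ (inv_mem hg))
  rwa [← adMap_mul, mul_inv_cancel, adMap_one] at this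

/-- Bruhat reduces this to a permutation `u`, which must be monotone because the matrix units on and
above the diagonal stay upper triangular; hence `u = 1`. -/
theorem mem_upperBorel_of_upperAlg_le {g : GL (Fin n) ℂ} (h : upperAlg n ≤ adMap g (upperAlg n)) :
    g ∈ upperBorel n := by
  obtain ⟨b, hb, u, c, hc, rfl⟩ := exists_bruhat g
  have h1 := adMap_mono b⁻¹ h
  rw [adMap_upperAlg_of_mem (inv_mem hb), mul_assoc, adMap_mul, ← adMap_mul b⁻¹ b,
    inv_mul_cancel, adMap_one, adMap_mul, adMap_upperAlg_of_mem hc] at h1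
  have hmono : ∀ i j, i ≤ j → u i ≤ u j := by
    intro i j hij
    by_contra hlt
    have h2 : Matrix.single i j (1 : ℂ) ∈ upperAlg n := by
      intro k l hkl
      rw [Matrix.single_apply, if_neg]
      rintro ⟨rfl, rfl⟩
      exact absurd hij (not_le.2 hkl)
    have h3 := (mem_adMap _ _ _).1 (h1 h2) (u i) (u j) (not_le.1 hlt)
    rw [conj_permGL_apply, show u⁻¹ (u i) = i from u.symm_apply_apply i,
      show u⁻¹ (u j) = j from u.symm_apply_apply j, Matrix.single_apply_same] at h3
    exact one_ne_zero h3
  have hu : permGL u = 1 := by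
    have hs : StrictMono u :=
      Monotone.strictMono_of_injective (fun i j hij => hmono i j hij) u.injective
    have : ∀ i, u i = i := fun i => by
      have := Subsingleton.elim (hs.orderIsoOfSurjective u u.surjective) (OrderIso.refl _)
      exact DFunLike.congr_fun this i
    ext i j
    rw [permGL_apply, this, Units.val_one, Matrix.one_apply]
  rw [hu, mul_one]
  exact mul_mem hb hc

theorem isBorel_upperAlg (n : ℕ) : IsBorel (upperAlg n) := by
  refine ⟨isSolvable_upperAlg n, fun c hc hle => ?_⟩
  obtain ⟨g, hg⟩ := exists_le_adMap_upperAlg c hc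
  rwa [adMap_upperAlg_of_mem (mem_upperBorel_of_upperAlg_le (hle.trans hg))] at hg

/-! ### Orbits as double cosets -/

/-- The base point of the flag variety. -/
def baseFlag (n : ℕ) : FlagVariety n := ⟨upperAlg n, isBorel_upperAlg n⟩

theorem exists_smul_baseFlag_eq (b : FlagVariety n) : ∃ g : GL (Fin n) ℂ, g • baseFlag n = b := by
  obtain ⟨g, hg⟩ := exists_le_adMap_upperAlg b.1 b.2.1
  exact ⟨g, Subtype.ext (le_antisymm (b.2.2 (isSolvable_adMap g (isSolvable_upperAlg n)) hg) hg)⟩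

theorem smul_baseFlag_eq_iff {g : GL (Fin n) ℂ} : g • baseFlag n = baseFlag n ↔ g ∈ upperBorel n :=
  ⟨fun h => mem_upperBorel_of_upperAlg_le (congrArg Subtype.val h).ge,
    fun h => Subtype.ext (adMap_upperAlg_of_mem h)⟩

theorem orbit_mk_smul_baseFlag_eq_iff {g h : GL (Fin n) ℂ} :
    (Quotient.mk _ (g • baseFlag n) : Orbits n) = Quotient.mk _ (h • baseFlag n) ↔
      ∃ c ∈ cornerBorel n, ∃ d ∈ upperBorel n, g = c * h * d := by
  rw [Quotient.eq, MulAction.orbitRel_apply]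
  constructor
  · rintro ⟨⟨c, hc⟩, hcg⟩
    refine ⟨c, hc, (c * h)⁻¹ * g, smul_baseFlag_eq_iff.1 ?_, by group⟩
    change c • h • baseFlag n = g • baseFlag n at hcg
    rw [mul_smul, ← hcg, ← mul_smul, ← mul_smul]
    simp
  · rintro ⟨c, hc, d, hd, rfl⟩
    refine ⟨⟨c, hc⟩, ?_⟩
    change c • h • baseFlag n = _
    rw [mul_smul, mul_smul, smul_baseFlag_eq_iff.2 hd]

/-- The orbits are parametrized by marked permutations. -/
theorem exists_bijective_markedPerms (n : ℕ) :
    ∃ f : markedPerms n → Orbits n, Function.Bijective f := by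
  choose t ht htA using fun x : markedPerms n => exists_lastCol_eq_indicator x.1.2 x.2.1
  refine ⟨fun x => Quotient.mk _ (((t x)⁻¹ * permGL x.1.1) • baseFlag n), fun x y hxy => ?_,
    fun o => ?_⟩
  · obtain ⟨c, hc, d, hd, h⟩ := orbit_mk_smul_baseFlag_eq_iff.1 hxy
    exact Subtype.ext (markedPerms_ext x.2 y.2 (ht x) (htA x) (ht y) (htA y) hc hd h)
  · induction o using Quotient.inductionOn with
    | h b =>
      obtain ⟨g, rfl⟩ := exists_smul_baseFlag_eq b
      obtain ⟨b, hb, u, d, hd, rfl⟩ := exists_bruhat g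
      obtain ⟨A, hA, h⟩ := exists_cornerBorel_normalForm u hb
      obtain ⟨c, hc, d', hd', h⟩ := h (t ⟨_, hA⟩) (ht ⟨_, hA⟩) (htA ⟨_, hA⟩)
      refine ⟨⟨_, hA⟩, (orbit_mk_smul_baseFlag_eq_iff.2 ⟨c, hc, d' * d, mul_mem hd' hd, ?_⟩).symm⟩
      rw [h]
      group

/-! ### Marked words and partitions into lists -/

/-- Mark the last letter of a word. -/
def markLast : List ℕ → List (ℕ × Bool)
  | [] => []
  | [a] => [(a, true)]
  | a :: b :: σ => (a, false) :: markLast (b :: σ)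

/-- Concatenate words, marking the last letter of each. -/
def joinMarked (L : List (List ℕ)) : List (ℕ × Bool) := L.flatMap markLast

/-- Add a letter in front of the first word. -/
def consHead (a : ℕ) : List (List ℕ) → List (List ℕ)
  | [] => [[a]]
  | σ :: L => (a :: σ) :: L

/-- Cut a word after each marked letter. -/
def splitMarked : List (ℕ × Bool) → List (List ℕ)
  | [] => []
  | (a, true) :: W => [a] :: splitMarked W
  | (a, false) :: W => consHead a (splitMarked W)

theorem splitMarked_markLast_append {σ : List ℕ} (hσ : σ ≠ []) (W : List (ℕ × Bool)) :
    splitMarked (markLast σ ++ W) = σ :: splitMarked W := by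
  induction σ using markLast.induct with
  | case1 => exact absurd rfl hσ
  | case2 a => rfl
  | case3 a b σ ih =>
    rw [markLast, List.cons_append, splitMarked, ih (List.cons_ne_nil _ _), consHead]

theorem splitMarked_joinMarked {L : List (List ℕ)} (hL : ∀ σ ∈ L, σ ≠ []) :
    splitMarked (joinMarked L) = L := by
  induction L with
  | nil => rfl
  | cons σ L ih =>
    rw [joinMarked, List.flatMap_cons, splitMarked_markLast_append (hL σ (by simp))]
    exact congrArg _ (ih fun τ hτ => hL τ (by simp [hτ]))

theorem ne_nil_of_mem_splitMarked {W : List (ℕ × Bool)} {σ : List ℕ} (hσ : σ ∈ splitMarked W) :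
    σ ≠ [] := by
  induction W using splitMarked.induct generalizing σ with
  | case1 => simp [splitMarked] at hσ
  | case2 a W ih =>
    rw [splitMarked, List.mem_cons] at hσ
    rcases hσ with rfl | hσ
    · simp
    · exact ih hσ
  | case3 a W ih =>
    rw [splitMarked] at hσ
    cases h : splitMarked W with
    | nil =>
      rw [h, consHead, List.mem_singleton] at hσ
      simp [hσ]
    | cons τ L =>
      rw [h] at ih
      rw [h, consHead, List.mem_cons] at hσ
      rcases hσ with rfl | hσ
      · simp
      · exact ih (by simp [hσ])

theorem markLast_cons (a : ℕ) {σ : List ℕ} (hσ : σ ≠ []) :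
    markLast (a :: σ) = (a, false) :: markLast σ := by
  cases σ with
  | nil => exact absurd rfl hσ
  | cons b σ => rfl

/-- A trailing run of unmarked letters would become a word of its own and have its last letter
marked on rejoining; the hypothesis excludes this. -/
theorem joinMarked_splitMarked {W : List (ℕ × Bool)} (hW : ∀ h : W ≠ [], (W.getLast h).2 = true) :
    joinMarked (splitMarked W) = W := by
  induction W using splitMarked.induct with
  | case1 => rfl
  | case2 a W ih =>
    rw [splitMarked, joinMarked, List.flatMap_cons]
    refine congrArg _ (ih fun h => ?_)
    have := hW (by simp)
    rwa [List.getLast_cons h] at this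
  | case3 a W ih =>
    have hne : W ≠ [] := by
      rintro rfl
      simpa using hW (by simp)
    have ih' := ih fun h => by
      have := hW (by simp)
      rwa [List.getLast_cons h] at this
    rw [splitMarked]
    cases h : splitMarked W with
    | nil =>
      rw [h] at ih'
      exact absurd ih'.symm hne
    | cons σ L =>
      have hσ : σ ≠ [] := ne_nil_of_mem_splitMarked (W := W) (by simp [h])
      rw [h, joinMarked, List.flatMap_cons] at ih'
      rw [consHead, joinMarked, List.flatMap_cons, markLast_cons a hσ, List.cons_append, ih']

theorem map_fst_markLast (σ : List ℕ) : (markLast σ).map Prod.fst = σ := by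
  induction σ using markLast.induct with
  | case1 => rfl
  | case2 a => rfl
  | case3 a b σ ih => rw [markLast, List.map_cons, ih]

theorem map_fst_joinMarked (L : List (List ℕ)) : (joinMarked L).map Prod.fst = L.flatten := by
  rw [joinMarked, List.map_flatMap, List.flatten_eq_flatMap]
  simp only [map_fst_markLast]
  rfl

theorem filter_markLast {σ : List ℕ} (hσ : σ ≠ []) :
    (markLast σ).filter Prod.snd = [(σ.getLastD 0, true)] := by
  induction σ using markLast.induct with
  | case1 => exact absurd rfl hσ
  | case2 a => rfl
  | case3 a b σ ih =>
    rw [markLast, List.filter_cons_of_neg (by simp), ih (List.cons_ne_nil _ _)]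
    simp

theorem filter_joinMarked {L : List (List ℕ)} (hL : ∀ σ ∈ L, σ ≠ []) :
    (joinMarked L).filter Prod.snd = L.map fun σ => (σ.getLastD 0, true) := by
  induction L with
  | nil => rfl
  | cons σ L ih =>
    rw [joinMarked, List.flatMap_cons, List.filter_append, filter_markLast (hL σ (by simp))]
    exact congrArg _ (ih fun τ hτ => hL τ (by simp [hτ]))

theorem getLast_markLast {σ : List ℕ} (h : markLast σ ≠ []) : ((markLast σ).getLast h).2 = true := by
  induction σ using markLast.induct with
  | case1 => exact absurd rfl h
  | case2 a => rfl
  | case3 a b σ ih =>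
    have hne : markLast (b :: σ) ≠ [] := by cases σ <;> simp [markLast]
    simp only [markLast, List.getLast_cons hne]
    exact ih hne

theorem getLast_joinMarked {L : List (List ℕ)} (h : joinMarked L ≠ []) :
    ((joinMarked L).getLast h).2 = true := by
  induction L with
  | nil => exact absurd rfl h
  | cons σ L ih =>
    by_cases hL : joinMarked L = []
    · have heq : joinMarked (σ :: L) = markLast σ := by
        rw [joinMarked, List.flatMap_cons]
        change _ ++ joinMarked L = _
        rw [hL, List.append_nil]
      simp only [heq]
      exact getLast_markLast _
    · have heq : joinMarked (σ :: L) = markLast σ ++ joinMarked L := rfl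
      simp only [heq, List.getLast_append_of_ne_nil _ hL]
      exact ih hL

/-- Partitions of `{1, …, n}` into lists, ordered by decreasing last letter. -/
def sortedPIL (n : ℕ) : Set (List (List ℕ)) :=
  {L | (∀ σ ∈ L, σ ≠ []) ∧ L.flatten.Nodup ∧ L.flatten.toFinset = Finset.Icc 1 n ∧
    L.Pairwise fun σ τ => τ.getLastD 0 < σ.getLastD 0}

/-- Arrangements of `{1, …, n}` with marked letters which are decreasing and include the last. -/
def markedWords (n : ℕ) : Set (List (ℕ × Bool)) :=
  {W | (∀ h : W ≠ [], (W.getLast h).2 = true) ∧ (W.map Prod.fst).Nodup ∧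
    (W.map Prod.fst).toFinset = Finset.Icc 1 n ∧
    W.Pairwise fun x y => x.2 = true → y.2 = true → y.1 < x.1}

/-- The marked letters of the joined word are exactly the last letters of its pieces, in order; the
default `0` is never used, the pieces being nonempty. -/
theorem pairwise_joinMarked_iff {L : List (List ℕ)} (hL : ∀ σ ∈ L, σ ≠ []) :
    ((joinMarked L).Pairwise fun x y => x.2 = true → y.2 = true → y.1 < x.1) ↔
      L.Pairwise fun σ τ => τ.getLastD 0 < σ.getLastD 0 := by
  rw [← List.pairwise_filter (p := Prod.snd) (R := fun x y : ℕ × Bool => y.1 < x.1),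
    filter_joinMarked hL, List.pairwise_map]

theorem bijOn_joinMarked (n : ℕ) : Set.BijOn joinMarked (sortedPIL n) (markedWords n) := by
  refine ⟨fun L hL => ?_, fun L hL L' hL' h => ?_, fun W hW => ?_⟩
  · refine ⟨fun h => getLast_joinMarked h, ?_, ?_, (pairwise_joinMarked_iff hL.1).2 hL.2.2.2⟩
    · rw [map_fst_joinMarked]; exact hL.2.1
    · rw [map_fst_joinMarked]; exact hL.2.2.1
  · rw [← splitMarked_joinMarked hL.1, h, splitMarked_joinMarked hL'.1]
  · have hne : ∀ σ ∈ splitMarked W, σ ≠ [] := fun σ hσ => ne_nil_of_mem_splitMarked hσ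
    have hjoin := joinMarked_splitMarked hW.1
    refine ⟨splitMarked W, ⟨hne, ?_, ?_, ?_⟩, hjoin⟩
    · rw [← map_fst_joinMarked, hjoin]; exact hW.2.1
    · rw [← map_fst_joinMarked, hjoin]; exact hW.2.2.1
    · rw [← pairwise_joinMarked_iff hne, hjoin]; exact hW.2.2.2

theorem getLastD_mem {σ : List ℕ} (hσ : σ ≠ []) : σ.getLastD 0 ∈ σ := by
  cases σ with
  | nil => exact absurd rfl hσ
  | cons a σ => rw [List.getLastD_cons]; exact List.getLastD_mem_cons

theorem bijOn_toFinset (n : ℕ) : Set.BijOn List.toFinset (sortedPIL n) (PIL n) := by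
  refine ⟨fun L hL => ?_, fun L hL L' hL' h => ?_, fun S hS => ?_⟩
  · obtain ⟨h1, h2⟩ := List.nodup_flatten.1 hL.2.1
    refine ⟨fun σ hσ => ?_, fun σ hσ τ hτ hne => ?_, ?_⟩
    · rw [List.mem_toFinset] at hσ
      exact ⟨hL.1 σ hσ, h1 σ hσ⟩
    · rw [List.mem_toFinset] at hσ hτ
      have : Std.Symm (List.Disjoint (α := ℕ)) := ⟨fun _ _ h => h.symm⟩
      exact List.disjoint_toFinset_iff_disjoint.2 (h2.forall hσ hτ hne)
    · rw [← hL.2.2.1]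
      ext a
      simp
  · have hnd : ∀ L ∈ sortedPIL n, L.Nodup := fun L hL =>
      hL.2.2.2.imp fun h => by rintro rfl; exact lt_irrefl _ h
    -- Two strictly sorted arrangements of the same set coincide.
    exact (List.perm_of_nodup_nodup_toFinset_eq (hnd L hL) (hnd L' hL') h).eq_of_pairwise
      (fun σ τ _ _ h1 h2 => absurd h1 h2.not_gt) hL.2.2.2 hL'.2.2.2
  · let r : List ℕ → List ℕ → Prop := fun σ τ => τ.getLastD 0 ≤ σ.getLastD 0
    have : Std.Total r := ⟨fun σ τ => le_total _ _⟩
    have : IsTrans (List ℕ) r := ⟨fun σ τ υ h1 h2 => le_trans h2 h1⟩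
    have : DecidableRel r := fun σ τ => Nat.decLe _ _
    let L := S.toList.insertionSort r
    have hperm : L.Perm S.toList := List.perm_insertionSort r _
    have hmem : ∀ σ, σ ∈ L ↔ σ ∈ S := fun σ => hperm.mem_iff.trans Finset.mem_toList
    have hnd : L.Nodup := hperm.nodup_iff.2 S.nodup_toList
    have hdisj : L.Pairwise List.Disjoint := hnd.pairwise_of_forall_ne fun σ hσ τ hτ hne =>
      List.disjoint_toFinset_iff_disjoint.1
        (hS.2.1 σ ((hmem σ).1 hσ) τ ((hmem τ).1 hτ) hne)
    have hne : ∀ σ ∈ L, σ ≠ [] := fun σ hσ => (hS.1 σ ((hmem σ).1 hσ)).1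
    refine ⟨L, ⟨hne, ?_, ?_, ?_⟩, ?_⟩
    · exact List.nodup_flatten.2 ⟨fun σ hσ => (hS.1 σ ((hmem σ).1 hσ)).2, hdisj⟩
    · rw [← hS.2.2]
      ext a
      simp [hmem]
    -- Sorting gives only a weak inequality; it is strict because disjoint nonempty lists cannot
    -- share a last letter.
    · refine ((List.pairwise_insertionSort r S.toList).and hdisj).imp_of_mem
        fun {σ τ} hσ hτ h => lt_of_le_of_ne h.1 fun heq => ?_
      exact h.2 (getLastD_mem (hne σ hσ)) (heq ▸ getLastD_mem (hne τ hτ))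
    · ext σ
      rw [List.mem_toFinset, hmem]

/-! ### Marked permutations as marked words -/

/-- The word of a marked permutation. -/
def markedWord (x : Equiv.Perm (Fin n) × Finset (Fin n)) : List (ℕ × Bool) :=
  List.ofFn fun i => ((x.1 i : ℕ) + 1, decide (i ∈ x.2))

theorem map_fst_markedWord (x : Equiv.Perm (Fin n) × Finset (Fin n)) :
    (markedWord x).map Prod.fst = List.ofFn fun i => (x.1 i : ℕ) + 1 := by
  rw [markedWord, List.map_ofFn]
  rfl

theorem bijOn_markedWord (n : ℕ) : Set.BijOn markedWord (markedPerms n) (markedWords n) := by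
  refine ⟨fun x hx => ⟨fun h => ?_, ?_, ?_, ?_⟩, fun x hx y hy h => ?_, fun W hW => ?_⟩
  · have hn : 0 < n := by
      rcases Nat.eq_zero_or_pos n with rfl | hn
      · exact absurd List.ofFn_zero h
      · exact hn
    simp only [markedWord, List.getLast_ofFn, decide_eq_true_eq]
    exact hx.1 _ (by simp only; omega)
  · rw [map_fst_markedWord, List.nodup_ofFn]
    intro i j hij
    exact x.1.injective (Fin.ext (by simpa using hij))
  · rw [map_fst_markedWord]
    ext a
    rw [List.mem_toFinset, List.mem_ofFn, Finset.mem_Icc]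
    constructor
    · rintro ⟨i, rfl⟩
      exact ⟨by omega, (x.1 i).2⟩
    · rintro ⟨h1, h2⟩
      refine ⟨x.1.symm ⟨a - 1, by omega⟩, ?_⟩
      simp only [Equiv.apply_symm_apply]
      omega
  · rw [markedWord, List.pairwise_ofFn]
    intro i j hij hi hj
    simp only [decide_eq_true_eq] at hi hj
    exact Nat.succ_lt_succ (hx.2 i hi j hj hij)
  · have h1 := List.ofFn_injective h
    refine Prod.ext (Equiv.ext fun i => Fin.ext ?_) (Finset.ext fun i => ?_)
    · simpa using congrArg Prod.fst (congrFun h1 i)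
    · simpa using congrArg Prod.snd (congrFun h1 i)
  · obtain ⟨hlast, hnd, hset, hpw⟩ := hW
    have hlen : W.length = n := by
      rw [← List.length_map (f := Prod.fst), ← List.toFinset_card_of_nodup hnd, hset]
      simp
    subst hlen
    have hIcc : ∀ i : Fin W.length, 1 ≤ (W.get i).1 ∧ (W.get i).1 ≤ W.length := fun i => by
      rw [← Finset.mem_Icc, ← hset, List.mem_toFinset]
      exact List.mem_map_of_mem (List.get_mem W i)
    -- Letters run from `1` and `Fin` from `0`; the lower bound in `hIcc` keeps the truncated
    -- subtraction faithful.
    let f : Fin W.length → Fin W.length := fun i => ⟨(W.get i).1 - 1, by have := hIcc i; omega⟩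
    have hf : Function.Injective f := by
      intro i j hij
      have h1 : (W.get i).1 = (W.get j).1 := by
        have := Fin.ext_iff.1 hij
        have hi := hIcc i
        have hj := hIcc j
        simp only [f] at this
        omega
      have h2 : (W.map Prod.fst)[(i : ℕ)]'(by simp) = (W.map Prod.fst)[(j : ℕ)]'(by simp) := by
        simpa using h1
      exact Fin.ext (hnd.getElem_inj_iff.1 h2)
    refine ⟨(Equiv.ofBijective f (Finite.injective_iff_bijective.1 hf),
      Finset.univ.filter fun i => (W.get i).2 = true), ⟨fun i hi => ?_, fun i hi j hj hij => ?_⟩, ?_⟩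
    · have hne : W ≠ [] := by rintro rfl; exact i.elim0
      have := hlast hne
      rw [List.getLast_eq_getElem] at this
      have hi' : W.length - 1 = i := by omega
      simp only [hi'] at this
      simpa using this
    · simp only [Finset.mem_filter, Finset.mem_univ, true_and] at hi hj
      have h1 := List.pairwise_iff_get.1 hpw i j hij hi hj
      have h2 := hIcc j
      rw [Fin.lt_def]
      change (W.get j).1 - 1 < (W.get i).1 - 1
      omega
    · conv_rhs => rw [← List.ofFn_get W]
      rw [markedWord]
      congr 1
      ext i
      · have := hIcc i
        change (W.get i).1 - 1 + 1 = (W.get i).1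
        omega
      · simp

theorem card_markedPerms (n : ℕ) : Nat.card (markedPerms n) = (PIL n).ncard := by
  rw [← Nat.card_coe_set_eq]
  exact Nat.card_congr (((bijOn_markedWord n).equiv _).trans
    (((bijOn_joinMarked n).equiv _).symm.trans ((bijOn_toFinset n).equiv _)))

end FlagOrbits

theorem mainTheorem3 (n : ℕ) :
    Finite (FlagOrbits.Orbits n) ∧
      Nat.card (FlagOrbits.Orbits n) = (FlagOrbits.PIL n).ncard := by
  obtain ⟨f, hf⟩ := FlagOrbits.exists_bijective_markedPerms n
  exact ⟨Finite.of_surjective f hf.2,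
    (Nat.card_congr (Equiv.ofBijective f hf)).symm.trans (FlagOrbits.card_markedPerms n)⟩
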